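/- Let $\{(\xi_{ni},\eta_{ni}):1\le i\le n,\ n\ge 1\}$ be a triangular array of bivariate Gaussian vectors (degenerate ones allowed) such that, for each $n$, the vectors $(\xi_{n1},\eta_{n1}),\dots,(\xi_{nn},\eta_{nn})$ are independent, with $E\xi_{ni}=E\eta_{ni}=0$ and $E\xi_{ni}^2=E\eta_{ni}^2=1$. For $n\ge 2$ let the correlation coefficient $\rho_{ni}$ of $(\xi_{ni},\eta_{ni})$ be $$\rho_{ni}=1-\frac{m(i/n)}{\log n},\qquad 1\le i\le n,$$ where the function $m=m_n$ on $[0,1]$ may depend on $n$ (necessarily $0\le m_n(i/n)\le 2\log n$). Let $\Phi$ be the standard Gaussian distribution function, and for $n\ge2$ let $b_n$ be given by $1-\Phi(b_n)=1/n$. For real $x_1,y_1,x_2,y_2$ put $$\mathbf u_n=(b_n+x_2/b_n,\ b_n+y_2/b_n),\qquad \mathbf v_n=(-b_n+x_1/b_n,\ -b_n+y_1/b_n),$$ $$\mathbf M_n=\Big(\max_{1\le i\le n}\xi_{ni},\ \max_{1\le i\le n}\eta_{ni}\Big),\qquad \mathbf m_n=\Big(\min_{1\le i\le n}\xi_{ni},\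 \min_{1\le i\le n}\eta_{ni}\Big),$$ with vector inequalities understood componentwise. Let $\Lambda(x)=\exp(-e^{-x})$, $H_0(x,y)=\Lambda(\min(x,y))$ and $\widetilde H_0(x,y)=1-\Lambda(-x)-\Lambda(-y)+\Lambda(\min(-x,-y))$. If $\lim_{n\to\infty}(\log n)^4\max_{1\le i\le n}m(i/n)=0$, then for all real $x_1,y_1,x_2,y_2$, $$\lim_{n\to\infty}(4\log n)\Big(P(\mathbf M_n\le\mathbf u_n,\ \mathbf m_n\le\mathbf v_n)-H_0(x_2,y_2)\widetilde H_0(x_1,y_1)\Big)$$ $$=\big\{[\min(x_2,y_2)]^2+2\min(x_2,y_2)\big\}e^{-\min(x_2,y_2)}H_0(x_2,y_2)\widetilde H_0(x_1,y_1)$$ $$-\big\{[x_1^2-2x_1]e^{x_1}\Lambda(-x_1)+[y_1^2-2y_1]e^{y_1}\Lambda(-y_1)\big\}H_0(x_2,y_2)$$ $$+\big\{[\max(x_1,y_1)]^2-2\max(x_1,y_1)\big\}e^{\max(x_1,y_1)}H_0(x_2,y_2)H_0(-x_1,-y_1).$$ -/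

import Mathlib

open MeasureTheory ProbabilityTheory Filter Topology

/-- The standard Gaussian distribution function `Φ`. -/
noncomputable def stdGaussianCDF (x : ℝ) : ℝ := cdf (gaussianReal 0 1) x

/-- The Gumbel distribution function `Λ(x) = exp(-e^{-x})`. -/
noncomputable def gumbel (x : ℝ) : ℝ := Real.exp (-Real.exp (-x))

/-- `H₀(x, y) = Λ(min(x, y))`, the limit law of the maxima under complete dependence. -/
noncomputable def Hzero (x y : ℝ) : ℝ := gumbel (min x y)

/-- `H̃₀(x, y) = 1 - Λ(-x) - Λ(-y) + Λ(min(-x, -y))`, the limit law of the minima under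
complete dependence. -/
noncomputable def Htilde (x y : ℝ) : ℝ :=
  1 - gumbel (-x) - gumbel (-y) + gumbel (min (-x) (-y))

/-- The correlation coefficient of `X` and `Y` under `μ`. -/
noncomputable def corrCoeff {Ω : Type*} [MeasurableSpace Ω] (X Y : Ω → ℝ) (μ : Measure Ω) : ℝ :=
  covariance X Y μ / (√(variance X μ) * √(variance Y μ))

/-- A triangular array of standard bivariate Gaussian vectors whose rows have independent entries:
row `n` consists of `n` vectors `(ξ n i, η n i)`, the index `i : Fin n` standing for the
position `i + 1 ∈ {1, …, n}`; these `n` vectors are independent, each is bivariate Gaussian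
(possibly degenerate), and all coordinates have mean `0` and second moment `1`. -/
structure IsStdBivariateGaussianArray {Ω : Type*} [MeasurableSpace Ω] (P : Measure Ω)
    (ξ η : (n : ℕ) → Fin n → Ω → ℝ) : Prop where
  gaussian : ∀ n i, HasGaussianLaw (fun ω => (ξ n i ω, η n i ω)) P
  indep : ∀ n, iIndepFun (fun (i : Fin n) ω => (ξ n i ω, η n i ω)) P
  mean_fst : ∀ n i, ∫ ω, ξ n i ω ∂P = 0
  mean_snd : ∀ n i, ∫ ω, η n i ω ∂P = 0
  sq_fst : ∀ n i, ∫ ω, (ξ n i ω) ^ 2 ∂P = 1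
  sq_snd : ∀ n i, ∫ ω, (η n i ω) ^ 2 ∂P = 1

/-- `max_{1 ≤ i ≤ n} X_{ni}(ω)` (for `n ≥ 1`). -/
noncomputable def rowMax {Ω : Type*} (X : (n : ℕ) → Fin n → Ω → ℝ) (n : ℕ) (ω : Ω) : ℝ :=
  ⨆ i : Fin n, X n i ω

/-- `min_{1 ≤ i ≤ n} X_{ni}(ω)` (for `n ≥ 1`). -/
noncomputable def rowMin {Ω : Type*} (X : (n : ℕ) → Fin n → Ω → ℝ) (n : ℕ) (ω : Ω) : ℝ :=
  ⨅ i : Fin n, X n i ω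

/-! The correlations are so close to `1` that, to order `1 / log n`, each `η n i` may be replaced by
`ξ n i`. The replacement matters only if some pair is separated by one of the levels used for `η`.
Separation at `w` forces either `|ξ - w| ≤ t` or `|ξ - η| ≥ t`; with `t = 1 / (log n)^2` and `Var(ξ
- η) = 2(1 - ρ) = o((log n)^(-5))`, the total probability over the row is `o(1 / log n)`
(`measureReal_crossing_le`, `abs_measureReal_row_sub_le`).

What remains concerns one i.i.d. standard Gaussian row at the levels `u = b n + x / b n` and `v = -b
n + y / b n`, where `x = min x₂ y₂` and `y = min x₁ y₁`. Its probability is exactly `Φ(u)^n - (Φ(u)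
- Φ(v))^n`. Both powers have the form `(1 - a n / n)^n`, where `a n` is a sum of terms `n (1 - Φ(b n
+ z / b n))`. A second-order Mills expansion (`tendsto_gaussianTail_ratio`) together with `log n /
(b n)^2 → 1/2` gives the `1 / log n` correction of `a n`, and `tendsto_log_mul_one_sub_div_pow`
carries it to the powers. -/

/-! ### Standard Gaussian density, distribution function and tail. -/

/-- The upper tail `1 - Φ` of the standard Gaussian law. -/
noncomputable def gaussianTail (t : ℝ) : ℝ := 1 - stdGaussianCDF t

lemma gaussianPDFReal_zero_one (t : ℝ) :
    gaussianPDFReal 0 1 t = (√(2 * Real.pi))⁻¹ * Real.exp (-t ^ 2 / 2) := by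
  simp [gaussianPDFReal]

lemma hasDerivAt_gaussianPDFReal (t : ℝ) :
    HasDerivAt (gaussianPDFReal 0 1) (-t * gaussianPDFReal 0 1 t) t := by
  have h : gaussianPDFReal 0 1 = fun t => (√(2 * Real.pi))⁻¹ * Real.exp (-t ^ 2 / 2) := by
    ext t; exact gaussianPDFReal_zero_one t
  have h1 : HasDerivAt (fun t : ℝ => -t ^ 2 / 2) (-t) t := by
    refine (((hasDerivAt_pow 2 t).fun_neg).div_const 2).congr_deriv ?_
    norm_num
    ring
  rw [h]
  refine (h1.exp.const_mul (√(2 * Real.pi))⁻¹).congr_deriv ?_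
  ring

lemma continuous_gaussianPDFReal : Continuous (gaussianPDFReal 0 1) :=
  continuous_iff_continuousAt.2 fun t => (hasDerivAt_gaussianPDFReal t).continuousAt

lemma stdGaussianCDF_eq_measure (t : ℝ) :
    stdGaussianCDF t = (gaussianReal 0 1).real (Set.Iic t) := by
  rw [stdGaussianCDF, cdf_eq_real]

lemma stdGaussianCDF_eq_integral (t : ℝ) :
    stdGaussianCDF t = ∫ x in Set.Iic t, gaussianPDFReal 0 1 x := by
  rw [stdGaussianCDF_eq_measure, measureReal_def, gaussianReal_apply_eq_integral _ one_ne_zero,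
    ENNReal.toReal_ofReal]
  exact integral_nonneg fun x => gaussianPDFReal_nonneg _ _ _

lemma hasDerivAt_stdGaussianCDF (t : ℝ) :
    HasDerivAt stdGaussianCDF (gaussianPDFReal 0 1 t) t := by
  have hi : ∀ s : Set ℝ, IntegrableOn (gaussianPDFReal 0 1) s :=
    fun s => (integrable_gaussianPDFReal 0 1).integrableOn
  have h : stdGaussianCDF = fun t => stdGaussianCDF 0 + ∫ x in (0 : ℝ)..t, gaussianPDFReal 0 1 x := by
    ext t
    rw [← intervalIntegral.integral_Iic_sub_Iic (hi _) (hi _), ← stdGaussianCDF_eq_integral,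
      ← stdGaussianCDF_eq_integral]
    ring
  rw [h]
  exact (continuous_gaussianPDFReal.integral_hasStrictDerivAt 0 t).hasDerivAt.const_add _

lemma hasDerivAt_gaussianTail (t : ℝ) :
    HasDerivAt gaussianTail (-gaussianPDFReal 0 1 t) t :=
  (hasDerivAt_stdGaussianCDF t).const_sub 1

lemma gaussianTail_eq_measure (t : ℝ) :
    gaussianTail t = (gaussianReal 0 1).real (Set.Ioi t) := by
  rw [gaussianTail, stdGaussianCDF_eq_measure, ← Set.compl_Iic, probReal_compl_eq_one_sub
    measurableSet_Iic]

lemma gaussianTail_pos (t : ℝ) : 0 < gaussianTail t := by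
  rw [gaussianTail_eq_measure, measureReal_def, ENNReal.toReal_pos_iff]
  refine ⟨pos_iff_ne_zero.2 fun h => ?_, measure_lt_top _ _⟩
  have := gaussianReal_absolutelyContinuous' 0 one_ne_zero h
  simp at this

lemma gaussianTail_antitone : Antitone gaussianTail := fun _ _ h =>
  sub_le_sub_left (monotone_cdf _ h) 1

lemma tendsto_gaussianTail : Tendsto gaussianTail atTop (𝓝 0) := by
  rw [← sub_self (1 : ℝ)]
  exact (tendsto_cdf_atTop (gaussianReal 0 1)).const_sub 1

lemma stdGaussianCDF_neg (t : ℝ) : stdGaussianCDF (-t) = gaussianTail t := by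
  have : NullSingletonClass (gaussianReal 0 1) := nullSingletonClass_gaussianReal one_ne_zero
  have h := gaussianReal_map_neg (μ := 0) (v := 1)
  rw [neg_zero] at h
  rw [gaussianTail_eq_measure, stdGaussianCDF_eq_measure, ← h,
    map_measureReal_apply measurable_neg measurableSet_Iic, h]
  have : (fun x : ℝ => -x) ⁻¹' Set.Iic (-t) = Set.Ici t := by ext; simp
  rw [this]
  exact measureReal_congr Ioi_ae_eq_Ici.symm

lemma tendsto_gaussianPDFReal : Tendsto (gaussianPDFReal 0 1) atTop (𝓝 0) := by
  have h1 : Tendsto (fun t : ℝ => -t ^ 2 / 2) atTop atBot := by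
    have := (tendsto_pow_atTop (α := ℝ) two_ne_zero).atTop_div_const (r := 2) two_pos
    refine (tendsto_neg_atTop_atBot.comp this).congr fun t => ?_
    simp [neg_div]
  have := (Real.tendsto_exp_atBot.comp h1).const_mul (√(2 * Real.pi))⁻¹
  rw [mul_zero] at this
  exact this.congr fun t => (gaussianPDFReal_zero_one t).symm

/-! ### Mills ratio asymptotics. -/

/-- The ratio `t (1 - Φ(t)) / φ(t)`. -/
noncomputable def millsQuotient (t : ℝ) : ℝ := t * gaussianTail t / gaussianPDFReal 0 1 t

lemma gaussianTail_eq_millsQuotient {t : ℝ} (ht : t ≠ 0) :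
    gaussianTail t = millsQuotient t * gaussianPDFReal 0 1 t / t := by
  have := (gaussianPDFReal_pos 0 1 t one_ne_zero).ne'
  rw [millsQuotient]; field_simp

/-- L'Hôpital's rule applies to `(φ/t - (1 - Φ)) / (φ/t^3)`: the derivatives are `-φ/t^2` and
`-φ/t^2 - 3φ/t^4`, with quotient `(1 + 3/t^2)⁻¹ → 1`. -/
lemma tendsto_sq_mul_one_sub_millsQuotient :
    Tendsto (fun t => t ^ 2 * (1 - millsQuotient t)) atTop (𝓝 1) := by
  have hp := fun t => gaussianPDFReal_pos 0 1 t one_ne_zero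
  have key : Tendsto (fun t => (gaussianPDFReal 0 1 t / t - gaussianTail t) /
      (gaussianPDFReal 0 1 t / t ^ 3)) atTop (𝓝 1) := by
    refine HasDerivAt.lhopital_zero_atTop (f' := fun t => -gaussianPDFReal 0 1 t / t ^ 2)
      (g' := fun t => -gaussianPDFReal 0 1 t / t ^ 2 - 3 * gaussianPDFReal 0 1 t / t ^ 4)
      ?_ ?_ ?_ ?_ ?_ ?_
    · filter_upwards [eventually_gt_atTop 0] with t ht
      refine (((hasDerivAt_gaussianPDFReal t).fun_div (hasDerivAt_id' t) ht.ne').fun_sub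
        (hasDerivAt_gaussianTail t)).congr_deriv ?_
      field_simp
      ring
    · filter_upwards [eventually_gt_atTop 0] with t ht
      refine ((hasDerivAt_gaussianPDFReal t).fun_div (hasDerivAt_pow 3 t)
        (pow_ne_zero 3 ht.ne')).congr_deriv ?_
      field_simp
      ring
    · filter_upwards [eventually_gt_atTop 0] with t ht
      have h1 : 0 < gaussianPDFReal 0 1 t / t ^ 2 := div_pos (hp t) (by positivity)
      have h2 : 0 < 3 * gaussianPDFReal 0 1 t / t ^ 4 :=
        div_pos (mul_pos (by norm_num) (hp t)) (by positivity)
      rw [neg_div]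
      linarith
    · simpa using (tendsto_gaussianPDFReal.div_atTop tendsto_id).sub tendsto_gaussianTail
    · exact tendsto_gaussianPDFReal.div_atTop (tendsto_pow_atTop (by norm_num))
    · have h1 : Tendsto (fun t : ℝ => (1 + 3 / t ^ 2)⁻¹) atTop (𝓝 1) := by
        have : Tendsto (fun t : ℝ => 3 / t ^ 2) atTop (𝓝 0) :=
          tendsto_const_nhds.div_atTop (tendsto_pow_atTop (by norm_num))
        simpa using (this.const_add 1).inv₀ (by norm_num)
      refine h1.congr' ?_
      filter_upwards [eventually_gt_atTop 0] with t ht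
      have h2 := (hp t).ne'
      have h3 : (t ^ 2 + 3 : ℝ) ≠ 0 := by positivity
      have e1 : -gaussianPDFReal 0 1 t / t ^ 2 - 3 * gaussianPDFReal 0 1 t / t ^ 4 =
        (-gaussianPDFReal 0 1 t / t ^ 2) * (1 + 3 / t ^ 2) := by field_simp; ring
      have e2 : -gaussianPDFReal 0 1 t / t ^ 2 ≠ 0 :=
        div_ne_zero (neg_ne_zero.2 h2) (pow_ne_zero 2 ht.ne')
      rw [e1, div_mul_eq_div_div, div_self e2, one_div]
  refine key.congr' ?_
  filter_upwards [eventually_gt_atTop 0] with t ht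
  have h2 := (hp t).ne'
  rw [millsQuotient]
  field_simp

lemma tendsto_millsQuotient : Tendsto millsQuotient atTop (𝓝 1) := by
  have h : Tendsto (fun t : ℝ => t ^ 2 * (1 - millsQuotient t) / t ^ 2) atTop (𝓝 0) :=
    tendsto_sq_mul_one_sub_millsQuotient.div_atTop (tendsto_pow_atTop (by norm_num))
  have h2 := h.const_sub 1
  rw [sub_zero] at h2
  refine h2.congr' ?_
  filter_upwards [eventually_gt_atTop 0] with t ht
  field_simp
  ring

lemma tendsto_neg_log_gaussianTail_div_sq :
    Tendsto (fun t => -Real.log (gaussianTail t) / t ^ 2) atTop (𝓝 (1 / 2)) := by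
  have hsq : Tendsto (fun t : ℝ => t ^ 2) atTop atTop := tendsto_pow_atTop (by norm_num)
  have h1 : Tendsto (fun t => (Real.log (√(2 * Real.pi)) - Real.log (millsQuotient t)) / t ^ 2)
      atTop (𝓝 0) :=
    (((tendsto_millsQuotient.log one_ne_zero).const_sub _)).div_atTop hsq
  have h2 : Tendsto (fun t : ℝ => Real.log t / t ^ 2) atTop (𝓝 0) := by
    have := (isLittleO_log_rpow_atTop (r := 2) two_pos).tendsto_div_nhds_zero
    simpa using this
  have h3 := (h1.add h2).add_const (1 / 2)
  rw [add_zero, zero_add] at h3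
  refine h3.congr' ?_
  filter_upwards [eventually_gt_atTop 0, tendsto_millsQuotient.eventually_ne one_ne_zero]
    with t ht hm
  have hs : √(2 * Real.pi) ≠ 0 := by positivity
  rw [gaussianTail_eq_millsQuotient ht.ne', gaussianPDFReal_zero_one, Real.log_div (by positivity)
    ht.ne', Real.log_mul hm (by positivity), Real.log_mul (by positivity) (by positivity),
    Real.log_inv, Real.log_exp]
  field_simp
  ring

/-! ### Second-order tail expansion at the levels `t + x / t`. -/

lemma tendsto_add_div_self (x : ℝ) : Tendsto (fun t : ℝ => t + x / t) atTop atTop :=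
  tendsto_id.atTop_add (tendsto_const_nhds.div_atTop tendsto_id)

lemma gaussianPDFReal_add_div {x t : ℝ} (ht : t ≠ 0) :
    gaussianPDFReal 0 1 (t + x / t) =
      gaussianPDFReal 0 1 t * Real.exp (-x - x ^ 2 / 2 * (t ^ 2)⁻¹) := by
  rw [gaussianPDFReal_zero_one, gaussianPDFReal_zero_one, mul_assoc, ← Real.exp_add]
  congr 2
  field_simp
  ring

/-- The delta method: since `s → ∞`, convergence of `s (d - a)` forces `d → a`, so differentiability
at `a` suffices. -/
lemma tendsto_smul_sub_of_hasDerivAt {α : Type*} {l : Filter α} {f : ℝ → ℝ} {f' a v : ℝ}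
    (hf : HasDerivAt f f' a) {s d : α → ℝ} (hs : Tendsto s l atTop)
    (hd : Tendsto (fun n => s n * (d n - a)) l (𝓝 v)) :
    Tendsto (fun n => s n * (f (d n) - f a)) l (𝓝 (v * f')) := by
  have h0 : Tendsto (fun n => d n - a) l (𝓝 0) := by
    refine (hd.div_atTop hs).congr' ?_
    filter_upwards [hs.eventually_gt_atTop 0] with n hn
    field_simp
  have := (hasFDerivWithinAt_univ.2 hf.hasFDerivAt).lim h0 (.of_forall fun _ => Set.mem_univ _)
    (c := s) (by simpa using hd)
  simpa using this

/-- The tail ratio is `F (1/t^2)` times a ratio of two Mills quotients. Both quotients are `1 -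
1/t^2 + o(1/t^2)`, so their ratio is `1 + o(1/t^2)` and the limit is just `F'(0)`. -/
lemma tendsto_gaussianTail_ratio (x : ℝ) :
    Tendsto (fun t => t ^ 2 * (gaussianTail (t + x / t) / gaussianTail t - Real.exp (-x))) atTop
      (𝓝 (-(x ^ 2 / 2 + x) * Real.exp (-x))) := by
  have hsq : Tendsto (fun t : ℝ => t ^ 2) atTop atTop := tendsto_pow_atTop (by norm_num)
  set u : ℝ → ℝ := fun t => t + x / t with hu
  have hut : Tendsto u atTop atTop := tendsto_add_div_self x
  set F : ℝ → ℝ := fun h => Real.exp (-x - x ^ 2 / 2 * h) / (1 + x * h) with hF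
  have hF' : HasDerivAt F (-(x ^ 2 / 2 + x) * Real.exp (-x)) 0 := by
    have h1 : HasDerivAt (fun h : ℝ => -x - x ^ 2 / 2 * h) (-(x ^ 2 / 2)) 0 := by
      simpa using ((hasDerivAt_id (0 : ℝ)).const_mul (x ^ 2 / 2)).const_sub (-x)
    have h2 : HasDerivAt (fun h : ℝ => 1 + x * h) x 0 := by
      simpa using ((hasDerivAt_id (0 : ℝ)).const_mul x).const_add 1
    refine (h1.exp.fun_div h2 (by simp)).congr_deriv ?_
    simp
    ring
  have hF1 : Tendsto (fun t : ℝ => t ^ 2 * (F (t ^ 2)⁻¹ - Real.exp (-x))) atTop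
      (𝓝 (-(x ^ 2 / 2 + x) * Real.exp (-x))) := by
    have h : Tendsto (fun t : ℝ => t ^ 2 * ((t ^ 2)⁻¹ - 0)) atTop (𝓝 1) := by
      refine tendsto_const_nhds.congr' ?_
      filter_upwards [eventually_gt_atTop 0] with t ht
      field_simp
      simp
    simpa [hF] using tendsto_smul_sub_of_hasDerivAt hF' hsq h
  have hR : Tendsto (fun t => millsQuotient (u t) / millsQuotient t) atTop (𝓝 1) := by
    have h := (tendsto_millsQuotient.comp hut).div tendsto_millsQuotient one_ne_zero
    rwa [div_one] at h
  have hquot : Tendsto (fun t => (t / u t) ^ 2) atTop (𝓝 1) := by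
    have h : Tendsto (fun t : ℝ => (1 + x / t ^ 2)⁻¹ ^ 2) atTop (𝓝 1) := by
      have h0 : Tendsto (fun t : ℝ => x / t ^ 2) atTop (𝓝 0) := tendsto_const_nhds.div_atTop hsq
      simpa using ((h0.const_add 1).inv₀ (by norm_num)).pow 2
    refine h.congr' ?_
    filter_upwards [eventually_gt_atTop 0, hut.eventually_gt_atTop 0] with t ht hut
    have : 1 + x / t ^ 2 = u t / t := by simp only [hu]; field_simp
    rw [this, inv_div]
  have hR1 : Tendsto (fun t => t ^ 2 * (millsQuotient (u t) / millsQuotient t - 1)) atTop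
      (𝓝 0) := by
    have h1 := hquot.mul (tendsto_sq_mul_one_sub_millsQuotient.comp hut)
    have h2 := (tendsto_sq_mul_one_sub_millsQuotient.sub h1).div tendsto_millsQuotient one_ne_zero
    rw [one_mul, sub_self, zero_div] at h2
    refine h2.congr' ?_
    filter_upwards [eventually_gt_atTop 0, hut.eventually_gt_atTop 0,
      tendsto_millsQuotient.eventually_ne one_ne_zero] with t ht hut hm
    simp only [Pi.div_apply, Function.comp]
    field_simp
    ring
  have h := (hF1.mul hR).add (hR1.const_mul (Real.exp (-x)))
  rw [mul_one, mul_zero, add_zero] at h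
  refine h.congr' ?_
  filter_upwards [eventually_gt_atTop 0, hut.eventually_gt_atTop 0,
      tendsto_millsQuotient.eventually_ne one_ne_zero] with t ht hut hm
  have hp := (gaussianPDFReal_pos 0 1 t one_ne_zero).ne'
  have e : gaussianTail (u t) / gaussianTail t =
      F (t ^ 2)⁻¹ * (millsQuotient (u t) / millsQuotient t) := by
    have : 1 + x * (t ^ 2)⁻¹ = u t / t := by simp only [hu]; field_simp
    simp only [hF]
    rw [gaussianTail_eq_millsQuotient ht.ne', gaussianTail_eq_millsQuotient hut.ne', this]
    rw [show gaussianPDFReal 0 1 (u t) = _ from gaussianPDFReal_add_div ht.ne']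
    field_simp
  simp only [hu] at e ⊢
  rw [e]
  ring

/-! ### Second-order limits of `(1 - a n / n)^n`. -/

lemma abs_log_one_sub_add_le {z : ℝ} (h1 : z < 1) :
    |Real.log (1 - z) + z| ≤ z ^ 2 / (1 - z) := by
  have hz : 0 < 1 - z := by linarith
  have ha := Real.log_le_sub_one_of_pos hz
  have hb := Real.one_sub_inv_le_log_of_pos hz
  have hc : 1 - (1 - z)⁻¹ + z = -(z ^ 2 / (1 - z)) := by field_simp; ring
  rw [abs_le]
  constructor
  · linarith
  · have : 0 ≤ z ^ 2 / (1 - z) := by positivity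
    linarith

/-- If `a n = a + c / log n + o(1 / log n)`, then `(1 - a n / n) ^ n` is
`exp (-a) - c exp (-a) / log n + o(1 / log n)`. -/
lemma tendsto_log_mul_one_sub_div_pow {a : ℕ → ℝ} {A c : ℝ} (ha0 : ∀ᶠ n in atTop, 0 ≤ a n)
    (ha : Tendsto (fun n : ℕ => Real.log n * (a n - A)) atTop (𝓝 c)) :
    Tendsto (fun n : ℕ => Real.log n * ((1 - a n / n) ^ n - Real.exp (-A))) atTop
      (𝓝 (-c * Real.exp (-A))) := by
  have hn : Tendsto (fun n : ℕ => (n : ℝ)) atTop atTop := tendsto_natCast_atTop_atTop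
  have hlog : Tendsto (fun n : ℕ => Real.log n) atTop atTop := Real.tendsto_log_atTop.comp hn
  have hA : Tendsto a atTop (𝓝 A) := by
    have := (ha.div_atTop hlog).add_const A
    rw [zero_add] at this
    refine this.congr' ?_
    filter_upwards [hlog.eventually_gt_atTop 0] with n hn
    field_simp
    ring
  have hz : Tendsto (fun n : ℕ => a n / n) atTop (𝓝 0) := hA.div_atTop hn
  have hln : Tendsto (fun n : ℕ => Real.log n / n) atTop (𝓝 0) := by
    exact (Real.isLittleO_log_id_atTop.tendsto_div_nhds_zero).comp hn
  -- The error of `log (1 - z) ≈ -z` at `z = a n / n` is of order `1 / n^2`; multiplied by `n log n`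
  -- it still vanishes.
  have hsmall : Tendsto (fun n : ℕ => Real.log n * (n * Real.log (1 - a n / n) + a n)) atTop
      (𝓝 0) := by
    have hbd : Tendsto (fun n : ℕ => Real.log n / n * (a n ^ 2 / (1 - a n / n))) atTop (𝓝 0) := by
      have := hln.mul ((hA.pow 2).div (hz.const_sub 1) (by norm_num))
      simpa using this
    refine squeeze_zero_norm' ?_ hbd
    filter_upwards [ha0, hz.eventually_lt_const one_pos, eventually_gt_atTop 0,
      hlog.eventually_gt_atTop 0] with n h0 h1 hn0 hl
    have hn0 : (0 : ℝ) < n := by exact_mod_cast hn0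
    have hb := abs_log_one_sub_add_le h1
    have h1' : 0 < 1 - a n / n := by linarith
    have e : Real.log n * (n * Real.log (1 - a n / n) + a n) =
        Real.log n * n * (Real.log (1 - a n / n) + a n / n) := by field_simp
    rw [e, norm_mul, Real.norm_eq_abs, Real.norm_eq_abs, abs_of_nonneg (by positivity)]
    refine (mul_le_mul_of_nonneg_left hb (by positivity)).trans (le_of_eq ?_)
    generalize 1 - a n / n = w at *
    field_simp
  have hexp : Tendsto (fun n : ℕ => Real.log n * (n * Real.log (1 - a n / n) - -A)) atTop
      (𝓝 (-c)) := by
    have := hsmall.sub ha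
    rw [zero_sub] at this
    exact this.congr fun n => by ring
  refine (tendsto_smul_sub_of_hasDerivAt (Real.hasDerivAt_exp (-A)) hlog hexp).congr' ?_
  filter_upwards [hz.eventually_lt_const one_pos] with n h1
  rw [← Real.log_pow, Real.exp_log (pow_pos (by linarith) n)]

/-! ### Probability that a level separates two nearly equal Gaussians. -/

lemma gaussianPDFReal_le_of_le_abs {r z : ℝ} (hr : 0 ≤ r) (h : r ≤ |z|) :
    gaussianPDFReal 0 1 z ≤ gaussianPDFReal 0 1 r := by
  rw [gaussianPDFReal_zero_one, gaussianPDFReal_zero_one]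
  have : r ^ 2 ≤ z ^ 2 := by
    rw [← sq_abs z]
    exact pow_le_pow_left₀ hr h 2
  gcongr

lemma gaussianReal_Icc_le {w t : ℝ} (ht : 0 ≤ t) (hw : t ≤ |w|) :
    (gaussianReal 0 1).real (Set.Icc (w - t) (w + t)) ≤ 2 * t * gaussianPDFReal 0 1 (|w| - t) := by
  have h0 : 0 ≤ ∫ x in Set.Icc (w - t) (w + t), gaussianPDFReal 0 1 x :=
    integral_nonneg fun x => gaussianPDFReal_nonneg _ _ _
  rw [measureReal_def, gaussianReal_apply_eq_integral _ one_ne_zero, ENNReal.toReal_ofReal h0]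
  calc ∫ x in Set.Icc (w - t) (w + t), gaussianPDFReal 0 1 x
      ≤ ∫ x in Set.Icc (w - t) (w + t), gaussianPDFReal 0 1 (|w| - t) := by
        refine setIntegral_mono_on (integrable_gaussianPDFReal 0 1).integrableOn ?_
          measurableSet_Icc fun x hx => ?_
        · exact integrableOn_const (by simp)
        · refine gaussianPDFReal_le_of_le_abs (by linarith) ?_
          have h1 := abs_sub_abs_le_abs_sub w x
          have h2 : |w - x| ≤ t := abs_le.2 ⟨by linarith [hx.2], by linarith [hx.1]⟩
          linarith
    _ = 2 * t * gaussianPDFReal 0 1 (|w| - t) := by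
        rw [setIntegral_const, smul_eq_mul, measureReal_def, Real.volume_Icc,
          ENNReal.toReal_ofReal (by linarith)]
        ring

section Pair

variable {Ω : Type*} [MeasurableSpace Ω] {P : Measure Ω} {X Y : Ω → ℝ}

lemma variance_eq_one_of_mean_zero (hX : AEMeasurable X P) (h1 : ∫ ω, X ω ∂P = 0)
    (h2 : ∫ ω, X ω ^ 2 ∂P = 1) : variance X P = 1 := by
  rw [variance_of_integral_eq_zero hX h1, h2]

lemma map_eq_stdGaussian [IsProbabilityMeasure P] (hX : HasGaussianLaw X P) (h1 : ∫ ω, X ω ∂P = 0)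
    (h2 : ∫ ω, X ω ^ 2 ∂P = 1) : P.map X = gaussianReal 0 1 := by
  rw [hX.map_eq_gaussianReal, variance_eq_one_of_mean_zero hX.aemeasurable h1 h2, h1]
  simp

/-- A Chernoff bound. Only an upper bound on the variance enters, so degenerate variables are
covered. -/
lemma ProbabilityTheory.HasGaussianLaw.measureReal_abs_ge_le [IsProbabilityMeasure P] (hX : HasGaussianLaw X P) (h1 : ∫ ω, X ω ∂P = 0)
    {v t : ℝ} (hv : variance X P ≤ v) (ht : 0 ≤ t) :
    P.real {ω | t ≤ |X ω|} ≤ 2 * Real.exp (-t ^ 2 / (2 * v)) := by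
  have hv0 : 0 ≤ v := (variance_nonneg X P).trans hv
  have hmap := hX.map_eq_gaussianReal
  rw [h1] at hmap
  have hsub : HasSubgaussianMGF X (NNReal.mk v hv0) P := by
    rw [← HasSubgaussianMGF.id_map_iff hX.aemeasurable, hmap]
    refine ⟨fun s => ?_, fun s => ?_⟩
    · simpa using integrable_exp_mul_gaussianReal (μ := 0) (v := (variance X P).toNNReal) s
    · rw [mgf_id_gaussianReal]
      simp only [zero_mul, zero_add, Real.coe_toNNReal _ (variance_nonneg X P)]
      gcongr
      exact hv
  have hsub' : HasSubgaussianMGF (-X) (NNReal.mk v hv0) P := hsub.neg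
  have ha := hsub.measure_ge_le ht
  have hb := hsub'.measure_ge_le ht
  have hle : {ω | t ≤ |X ω|} ⊆ {ω | t ≤ X ω} ∪ {ω | t ≤ (-X) ω} := by
    intro ω hω
    exact le_abs.1 (show t ≤ |X ω| from hω)
  calc _ ≤ P.real {ω | t ≤ X ω} + P.real {ω | t ≤ (-X) ω} :=
        (measureReal_mono hle).trans (measureReal_union_le _ _)
    _ ≤ _ := by
      rw [two_mul]
      exact add_le_add ha hb

/-- Two standard Gaussian variables whose difference has small variance are unlikely to lie on
different sides of a level. -/
lemma measureReal_crossing_le [IsProbabilityMeasure P] (hXY : HasGaussianLaw (fun ω => (X ω, Y ω)) P)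
    (hX1 : ∫ ω, X ω ∂P = 0) (hY1 : ∫ ω, Y ω ∂P = 0)
    (hX2 : ∫ ω, X ω ^ 2 ∂P = 1) (hY2 : ∫ ω, Y ω ^ 2 ∂P = 1) {v t w : ℝ}
    (hv : 2 * (1 - corrCoeff X Y P) ≤ v) (ht : 0 ≤ t) (hw : t ≤ |w|) :
    P.real {ω | ¬(X ω ≤ w ↔ Y ω ≤ w)} ≤
      2 * t * gaussianPDFReal 0 1 (|w| - t) + 2 * Real.exp (-t ^ 2 / (2 * v)) := by
  have hX := hXY.fst
  have hY := hXY.snd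
  have vX := variance_eq_one_of_mean_zero hX.aemeasurable hX1 hX2
  have vY := variance_eq_one_of_mean_zero hY.aemeasurable hY1 hY2
  -- Joint Gaussianity is essential here: it makes the difference Gaussian.
  have hD : HasGaussianLaw (fun ω => X ω - Y ω) P := hXY.fun_sub
  have vD : variance (fun ω => X ω - Y ω) P ≤ v := by
    rw [variance_fun_sub hX.memLp_two hY.memLp_two, vX, vY]
    rw [corrCoeff, vX, vY] at hv
    norm_num at hv
    linarith
  have mD : ∫ ω, (X ω - Y ω) ∂P = 0 := by
    rw [integral_sub hX.integrable hY.integrable, hX1, hY1, sub_zero]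
  have hA := hD.measureReal_abs_ge_le mD vD ht
  have hB : P.real (X ⁻¹' Set.Icc (w - t) (w + t)) ≤ 2 * t * gaussianPDFReal 0 1 (|w| - t) := by
    rw [← map_measureReal_apply_of_aemeasurable hX.aemeasurable measurableSet_Icc,
      map_eq_stdGaussian hX hX1 hX2]
    exact gaussianReal_Icc_le ht hw
  -- If `X` is farther than `t` from `w` and `Y` is within `t` of `X`, both lie on the same side of
  -- `w`.
  have hle : {ω | ¬(X ω ≤ w ↔ Y ω ≤ w)} ⊆
      X ⁻¹' Set.Icc (w - t) (w + t) ∪ {ω | t ≤ |X ω - Y ω|} := by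
    intro ω hω
    by_contra hcon
    simp only [Set.mem_union, Set.mem_preimage, Set.mem_Icc, Set.mem_ofPred_eq, not_or, not_and,
      not_le] at hcon
    obtain ⟨h1, h2⟩ := hcon
    rw [abs_lt] at h2
    apply hω
    constructor <;> intro h
    · by_contra h3
      linarith [h1 (by linarith)]
    · by_contra h3
      linarith [h1 (by linarith)]
  calc _ ≤ P.real (X ⁻¹' Set.Icc (w - t) (w + t)) + P.real {ω | t ≤ |X ω - Y ω|} :=
        (measureReal_mono hle).trans (measureReal_union_le _ _)
    _ ≤ _ := add_le_add hB hA

end Pair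

/-! ### Maxima and minima of one row. -/

section Row

variable {Ω : Type*} [MeasurableSpace Ω] {P : Measure Ω}

lemma measureReal_forall_mem_eq_pow {n : ℕ} {X : Fin n → Ω → ℝ} (hX : ∀ i, AEMeasurable (X i) P)
    (hmap : ∀ i, P.map (X i) = gaussianReal 0 1) (hind : iIndepFun X P) {s : Set ℝ}
    (hs : MeasurableSet s) :
    P.real {ω | ∀ i, X i ω ∈ s} = (gaussianReal 0 1).real s ^ n := by
  have h := hind.measure_inter_preimage_eq_mul Finset.univ (sets := fun _ => s) fun _ _ => hs
  have e : {ω | ∀ i, X i ω ∈ s} = ⋂ i ∈ Finset.univ, X i ⁻¹' s := by ext; simp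
  have h2 : ∀ i, P (X i ⁻¹' s) = gaussianReal 0 1 s := fun i => by
    rw [← hmap i, Measure.map_apply_of_aemeasurable (hX i) hs]
  rw [measureReal_def, e, h, Finset.prod_congr rfl fun i _ => h2 i]
  simp [measureReal_def]

/-- Given that all entries are at most `u`, the minimum exceeds `v` exactly when all entries lie in
`(v, u]`; independence turns both events into powers. -/
lemma measureReal_max_le_min_le [IsProbabilityMeasure P] {n : ℕ} {X : Fin n → Ω → ℝ} (hX : ∀ i, AEMeasurable (X i) P)
    (hmap : ∀ i, P.map (X i) = gaussianReal 0 1) (hind : iIndepFun X P) {u v : ℝ} (huv : v ≤ u) :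
    P.real {ω | (∀ i, X i ω ≤ u) ∧ ∃ i, X i ω ≤ v} =
      stdGaussianCDF u ^ n - (stdGaussianCDF u - stdGaussianCDF v) ^ n := by
  have e : {ω | (∀ i, X i ω ≤ u) ∧ ∃ i, X i ω ≤ v} =
      {ω | ∀ i, X i ω ∈ Set.Iic u} \ {ω | ∀ i, X i ω ∈ Set.Ioc v u} := by
    ext ω
    simp only [Set.mem_ofPred_eq, Set.mem_sdiff, Set.mem_Iic, Set.mem_Ioc, not_forall, not_and,
      not_le]
    constructor
    · rintro ⟨h1, i, hi⟩
      exact ⟨h1, i, fun h => absurd hi (not_le.2 h)⟩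
    · rintro ⟨h1, i, hi⟩
      exact ⟨h1, i, not_lt.1 fun h => absurd (h1 i) (not_le.2 (hi h))⟩
  have hms : NullMeasurableSet {ω | ∀ i, X i ω ∈ Set.Ioc v u} P := by
    rw [Set.ofPred_forall]
    exact NullMeasurableSet.iInter fun i => (hX i).nullMeasurableSet_preimage measurableSet_Ioc
  have hsub : {ω | ∀ i, X i ω ∈ Set.Ioc v u} ⊆ {ω | ∀ i, X i ω ∈ Set.Iic u} :=
    fun ω h i => (h i).2
  have hIoc : (gaussianReal 0 1).real (Set.Ioc v u) = stdGaussianCDF u - stdGaussianCDF v := by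
    have : Set.Ioc v u = Set.Iic u \ Set.Iic v := by ext; simp [and_comm]
    rw [stdGaussianCDF_eq_measure, stdGaussianCDF_eq_measure, this,
      measureReal_sdiff (Set.Iic_subset_Iic.2 huv) measurableSet_Iic]
  rw [e, measureReal_def, measure_sdiff hsub hms (measure_ne_top _ _),
    ENNReal.toReal_sub_of_le (measure_mono hsub) (measure_ne_top _ _), ← measureReal_def,
    ← measureReal_def, measureReal_forall_mem_eq_pow hX hmap hind measurableSet_Iic,
    measureReal_forall_mem_eq_pow hX hmap hind measurableSet_Ioc, hIoc, stdGaussianCDF_eq_measure]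

lemma rowMax_le_iff {Ω : Type*} (X : (n : ℕ) → Fin n → Ω → ℝ) {n : ℕ} (hn : 0 < n) (ω : Ω) (u : ℝ) :
    rowMax X n ω ≤ u ↔ ∀ i, X n i ω ≤ u := by
  have : Nonempty (Fin n) := ⟨⟨0, hn⟩⟩
  exact ciSup_le_iff (Set.finite_range _).bddAbove

lemma rowMin_le_iff {Ω : Type*} (X : (n : ℕ) → Fin n → Ω → ℝ) {n : ℕ} (hn : 0 < n) (ω : Ω) (v : ℝ) :
    rowMin X n ω ≤ v ↔ ∃ i, X n i ω ≤ v := by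
  have : Nonempty (Fin n) := ⟨⟨0, hn⟩⟩
  constructor
  · intro h
    obtain ⟨i, hi⟩ := exists_eq_ciInf_of_finite (f := fun i => X n i ω)
    exact ⟨i, hi.le.trans h⟩
  · rintro ⟨i, hi⟩
    exact (ciInf_le (Set.finite_range _).bddBelow i).trans hi

lemma abs_measureReal_sub_le_of_iff [IsProbabilityMeasure P] {A B D : Set Ω} (h : ∀ ω, ω ∉ D → (ω ∈ A ↔ ω ∈ B)) :
    |P.real A - P.real B| ≤ P.real D := by
  have hA : P.real A ≤ P.real B + P.real D := by
    refine (measureReal_mono fun ω hω => ?_).trans (measureReal_union_le _ _)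
    by_cases hD : ω ∈ D
    · exact Or.inr hD
    · exact Or.inl ((h ω hD).1 hω)
  have hB : P.real B ≤ P.real A + P.real D := by
    refine (measureReal_mono fun ω hω => ?_).trans (measureReal_union_le _ _)
    by_cases hD : ω ∈ D
    · exact Or.inr hD
    · exact Or.inl ((h ω hD).2 hω)
  rw [abs_le]
  constructor <;> linarith

/-- Replacing the second coordinates of a row by the first ones changes the joint law of the
maxima and minima by at most the total crossing probability. -/
lemma abs_measureReal_row_sub_le [IsProbabilityMeasure P] {n : ℕ} {X Y : Fin n → Ω → ℝ} {u₁ u₂ v₁ v₂ e : ℝ}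
    (hu : ∀ i, P.real {ω | ¬(X i ω ≤ u₂ ↔ Y i ω ≤ u₂)} ≤ e)
    (hv : ∀ i, P.real {ω | ¬(X i ω ≤ v₂ ↔ Y i ω ≤ v₂)} ≤ e) :
    |P.real {ω | ((∀ i, X i ω ≤ u₁) ∧ ∀ i, Y i ω ≤ u₂) ∧ (∃ i, X i ω ≤ v₁) ∧ ∃ i, Y i ω ≤ v₂} -
      P.real {ω | (∀ i, X i ω ≤ min u₁ u₂) ∧ ∃ i, X i ω ≤ min v₁ v₂}| ≤ n * (e + e) := by
  set D : Fin n → Set Ω := fun i =>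
    {ω | ¬(X i ω ≤ u₂ ↔ Y i ω ≤ u₂)} ∪ {ω | ¬(X i ω ≤ v₂ ↔ Y i ω ≤ v₂)}
  have hD : P.real (⋃ i, D i) ≤ n * (e + e) := by
    refine (measureReal_iUnion_fintype_le D).trans ?_
    refine (Finset.sum_le_card_nsmul _ _ (e + e) fun i _ => ?_).trans
      (le_of_eq (by rw [Finset.card_univ, Fintype.card_fin, nsmul_eq_mul]))
    exact (measureReal_union_le _ _).trans (add_le_add (hu i) (hv i))
  refine (abs_measureReal_sub_le_of_iff fun ω hω => ?_).trans hD
  simp only [D, Set.mem_iUnion, Set.mem_union, Set.mem_ofPred_eq, not_exists, not_or, not_not] at hω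
  have h1 : (∀ i, Y i ω ≤ u₂) ↔ ∀ i, X i ω ≤ u₂ := forall_congr' fun i => (hω i).1.symm
  have h2 : (∃ i, Y i ω ≤ v₂) ↔ ∃ i, X i ω ≤ v₂ := exists_congr fun i => (hω i).2.symm
  simp only [Set.mem_ofPred_eq]
  rw [h1, h2, ← forall_and]
  simp only [le_min_iff]
  refine and_congr_right fun _ => ?_
  -- Both existential conditions now concern the same `X`, and the one for the smaller level implies
  -- the other.
  rcases le_total v₁ v₂ with h | h
  · exact ⟨fun ⟨⟨i, hi⟩, _⟩ => ⟨i, hi, hi.trans h⟩, fun ⟨i, hi⟩ => ⟨⟨i, hi.1⟩, i, hi.2⟩⟩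
  · exact ⟨fun ⟨_, i, hi⟩ => ⟨i, hi.trans h, hi⟩, fun ⟨i, hi⟩ => ⟨⟨i, hi.1⟩, i, hi.2⟩⟩

end Row

/-! ### The normalising sequence `b n` and the i.i.d. expansion. -/

lemma tendsto_log_natCast : Tendsto (fun n : ℕ => Real.log n) atTop atTop :=
  Real.tendsto_log_atTop.comp tendsto_natCast_atTop_atTop

section Quantile

variable {b : ℕ → ℝ} (hb : ∀ n : ℕ, 2 ≤ n → gaussianTail (b n) = 1 / (n : ℝ))
include hb

lemma tendsto_gaussianQuantile : Tendsto b atTop atTop := by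
  refine tendsto_atTop.2 fun K => ?_
  have h : Tendsto (fun n : ℕ => 1 / (n : ℝ)) atTop (𝓝 0) :=
    tendsto_const_nhds.div_atTop tendsto_natCast_atTop_atTop
  filter_upwards [h.eventually_lt_const (gaussianTail_pos K), eventually_ge_atTop 2] with n h1 h2
  rw [← hb n h2] at h1
  by_contra hK
  exact absurd (gaussianTail_antitone (not_le.1 hK).le) (not_le.2 h1)

lemma tendsto_log_div_gaussianQuantile_sq :
    Tendsto (fun n : ℕ => Real.log n / b n ^ 2) atTop (𝓝 (1 / 2)) := by
  refine (tendsto_neg_log_gaussianTail_div_sq.comp (tendsto_gaussianQuantile hb)).congr' ?_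
  filter_upwards [eventually_ge_atTop 2] with n hn
  simp only [Function.comp]
  rw [hb n hn, one_div, Real.log_inv, neg_neg]

lemma tendsto_gaussianQuantile_div_log :
    Tendsto (fun n : ℕ => b n / Real.log n) atTop (𝓝 0) := by
  have h := ((tendsto_log_div_gaussianQuantile_sq hb).inv₀ (by norm_num)).div_atTop
    (tendsto_gaussianQuantile hb)
  refine h.congr' ?_
  filter_upwards [(tendsto_gaussianQuantile hb).eventually_gt_atTop 0] with n hn
  rw [inv_div]
  field_simp

lemma tendsto_log_mul_gaussianTail (x : ℝ) :
    Tendsto (fun n : ℕ => Real.log n * (n * gaussianTail (b n + x / b n) - Real.exp (-x))) atTop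
      (𝓝 (1 / 2 * (-(x ^ 2 / 2 + x) * Real.exp (-x)))) := by
  have hbt := tendsto_gaussianQuantile hb
  refine ((tendsto_log_div_gaussianQuantile_sq hb).mul
    ((tendsto_gaussianTail_ratio x).comp hbt)).congr' ?_
  filter_upwards [hbt.eventually_gt_atTop 0, eventually_ge_atTop 2] with n hn h2
  simp only [Function.comp]
  rw [hb n h2]
  field_simp

/-- This is the contribution of `ξ` falling within `1 / (log n)^2` of a level. Since `n φ(b n)` is
asymptotic to `b n`, it has order at most `b n / log n → 0`; the shift of the level only changes `x`
by `b n / (log n)^2 → 0`. -/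
lemma tendsto_log_mul_gaussianPDFReal (x : ℝ) :
    Tendsto (fun n : ℕ => Real.log n * (n * (2 * (1 / Real.log n ^ 2) *
      gaussianPDFReal 0 1 (b n + x / b n - 1 / Real.log n ^ 2)))) atTop (𝓝 0) := by
  have hbt := tendsto_gaussianQuantile hb
  have hbl := tendsto_gaussianQuantile_div_log hb
  have hbt2 : Tendsto (fun n => b n / Real.log n / Real.log n) atTop (𝓝 0) :=
    hbl.div_atTop tendsto_log_natCast
  have hlim : Tendsto (fun n : ℕ => 2 * (b n / Real.log n) * (millsQuotient (b n))⁻¹ *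
      Real.exp (-(x - b n / Real.log n / Real.log n))) atTop (𝓝 0) := by
    have := ((hbl.const_mul 2).mul ((tendsto_millsQuotient.comp hbt).inv₀ one_ne_zero)).mul
      ((Real.continuous_exp.tendsto _).comp (hbt2.const_sub x).neg)
    rw [mul_zero, zero_mul, zero_mul] at this
    exact this
  refine squeeze_zero' ?_ ?_ hlim
  · filter_upwards [tendsto_log_natCast.eventually_gt_atTop 0] with n hn
    have := gaussianPDFReal_nonneg 0 1 (b n + x / b n - 1 / Real.log n ^ 2)
    positivity
  · filter_upwards [tendsto_log_natCast.eventually_gt_atTop 0, hbt.eventually_gt_atTop 0,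
      eventually_ge_atTop 2] with n hl hb0 h2
    have hp := gaussianPDFReal_pos 0 1 (b n) one_ne_zero
    have hn : (0 : ℝ) < n := by positivity
    have hm : (millsQuotient (b n))⁻¹ = n * gaussianPDFReal 0 1 (b n) / b n := by
      rw [millsQuotient, hb n h2, inv_div]
      field_simp
    have e : b n + x / b n - 1 / Real.log n ^ 2 =
        b n + (x - b n / Real.log n / Real.log n) / b n := by
      field_simp
      ring
    rw [e, gaussianPDFReal_add_div hb0.ne', hm]
    set z := x - b n / Real.log n / Real.log n
    have hexp : Real.exp (-z - z ^ 2 / 2 * (b n ^ 2)⁻¹) ≤ Real.exp (-z) := by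
      apply Real.exp_le_exp.2
      have : 0 ≤ z ^ 2 / 2 * (b n ^ 2)⁻¹ := by positivity
      linarith
    calc _ = 2 * n * gaussianPDFReal 0 1 (b n) / Real.log n *
          Real.exp (-z - z ^ 2 / 2 * (b n ^ 2)⁻¹) := by field_simp
      _ ≤ 2 * n * gaussianPDFReal 0 1 (b n) / Real.log n * Real.exp (-z) := by gcongr
      _ = _ := by field_simp

/-- The joint second-order expansion for the maximum and the minimum of `n` independent standard
Gaussian variables. -/
lemma tendsto_log_mul_max_min (x y : ℝ) :
    Tendsto (fun n : ℕ => 4 * Real.log n *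
      ((stdGaussianCDF (b n + x / b n) ^ n -
        (stdGaussianCDF (b n + x / b n) - stdGaussianCDF (-b n + y / b n)) ^ n) -
        gumbel x * (1 - gumbel (-y)))) atTop
      (𝓝 ((x ^ 2 + 2 * x) * Real.exp (-x) * gumbel x * (1 - gumbel (-y)) -
        (y ^ 2 - 2 * y) * Real.exp y * gumbel (-y) * gumbel x)) := by
  have ha := tendsto_log_mul_gaussianTail hb x
  have hc := tendsto_log_mul_gaussianTail hb (-y)
  have hac := (ha.add hc).congr fun n => by
    rw [← mul_add, ← add_sub_add_comm]
  have hnn : ∀ (n : ℕ) t, 0 ≤ n * gaussianTail t :=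
    fun n t => mul_nonneg n.cast_nonneg (gaussianTail_pos t).le
  -- The first power involves the upper tail alone, the second the sum of both tails; the lower tail
  -- is reflected to the level `b n + -y / b n`.
  have h1 := tendsto_log_mul_one_sub_div_pow (.of_forall fun n => hnn n _) ha
  have h2 := tendsto_log_mul_one_sub_div_pow
    (.of_forall fun n => add_nonneg (hnn n _) (hnn n _)) hac
  have h := (h1.sub h2).const_mul 4
  have eg : Real.exp (-(Real.exp (-x) + Real.exp y)) = gumbel x * gumbel (-y) := by
    rw [gumbel, gumbel, ← Real.exp_add, neg_neg]
    ring_nf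
  have eg1 : Real.exp (-Real.exp (-x)) = gumbel x := rfl
  simp only [neg_neg, eg, eg1] at h
  convert! h.congr' ?_ using 2
  · ring
  · filter_upwards [eventually_ge_atTop 2] with n hn
    have hn0 : (n : ℝ) ≠ 0 := by positivity
    have e1 : stdGaussianCDF (b n + x / b n) = 1 - n * gaussianTail (b n + x / b n) / n := by
      rw [gaussianTail]
      field_simp
      ring
    have e2 : stdGaussianCDF (b n + x / b n) - stdGaussianCDF (-b n + y / b n) =
        1 - (n * gaussianTail (b n + x / b n) + n * gaussianTail (b n + -y / b n)) / n := by
      rw [show -b n + y / b n = -(b n + -y / b n) by ring, stdGaussianCDF_neg, ← mul_add,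
        mul_div_cancel_left₀ _ hn0, gaussianTail.eq_1 (b n + x / b n)]
      ring
    rw [e2, e1]
    ring

end Quantile

/-! ### Comparison with the i.i.d. row and conclusion. -/

lemma tendsto_log_mul_exp_neg_log :
    Tendsto (fun n : ℕ => Real.log n * (n * (2 * Real.exp (-(4 * Real.log n))))) atTop (𝓝 0) := by
  have h : Tendsto (fun n : ℕ => 2 * (Real.log n / (n : ℝ) ^ 3)) atTop (𝓝 0) := by
    have := ((isLittleO_log_rpow_atTop (r := 3) (by norm_num)).tendsto_div_nhds_zero.comp
      tendsto_natCast_atTop_atTop (α := ℕ)).const_mul 2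
    rw [mul_zero] at this
    refine this.congr fun n => ?_
    simp only [Function.comp]
    norm_cast
  refine h.congr' ?_
  filter_upwards [eventually_ge_atTop 2] with n hn
  have hn0 : (0 : ℝ) < n := by positivity
  have : Real.exp (-(4 * Real.log n)) = ((n : ℝ) ^ 4)⁻¹ := by
    rw [Real.exp_neg, show (4 : ℝ) * Real.log n = ((4 : ℕ) : ℝ) * Real.log n by norm_num,
      Real.exp_nat_mul, Real.exp_log hn0]
  rw [this]
  field_simp

lemma Htilde_eq (x y : ℝ) : Htilde x y = 1 - gumbel (-min x y) := by
  rw [Htilde]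
  rcases le_total x y with h | h
  · rw [min_eq_left h, min_eq_right (neg_le_neg h)]; ring
  · rw [min_eq_right h, min_eq_left (neg_le_neg h)]; ring

theorem theorem3 {Ω : Type*} [MeasurableSpace Ω] (P : Measure Ω) [IsProbabilityMeasure P]
    (ξ η : (n : ℕ) → Fin n → Ω → ℝ) (hA : IsStdBivariateGaussianArray P ξ η)
    (m : ℕ → ℝ → ℝ)
    (hρ : ∀ n : ℕ, 2 ≤ n → ∀ i : Fin n,
      corrCoeff (ξ n i) (η n i) P = 1 - m n (((i : ℕ) + 1 : ℝ) / n) / Real.log n)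
    (hm : Tendsto (fun n : ℕ =>
      (Real.log n) ^ 4 * ⨆ i : Fin n, m n (((i : ℕ) + 1 : ℝ) / n)) atTop (𝓝 0))
    (b : ℕ → ℝ) (hb : ∀ n : ℕ, 2 ≤ n → 1 - stdGaussianCDF (b n) = 1 / (n : ℝ))
    (x₁ y₁ x₂ y₂ : ℝ) :
    Tendsto (fun n : ℕ => 4 * Real.log n *
        (P.real {ω | (rowMax ξ n ω ≤ b n + x₂ / b n ∧ rowMax η n ω ≤ b n + y₂ / b n) ∧
            (rowMin ξ n ω ≤ -b n + x₁ / b n ∧ rowMin η n ω ≤ -b n + y₁ / b n)}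
          - Hzero x₂ y₂ * Htilde x₁ y₁)) atTop
      (𝓝 (((min x₂ y₂) ^ 2 + 2 * min x₂ y₂) * Real.exp (-min x₂ y₂)
            * Hzero x₂ y₂ * Htilde x₁ y₁
          - ((x₁ ^ 2 - 2 * x₁) * Real.exp x₁ * gumbel (-x₁)
              + (y₁ ^ 2 - 2 * y₁) * Real.exp y₁ * gumbel (-y₁)) * Hzero x₂ y₂
          + ((max x₁ y₁) ^ 2 - 2 * max x₁ y₁) * Real.exp (max x₁ y₁)
            * Hzero x₂ y₂ * Hzero (-x₁) (-y₁))) := by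
  have hb' : ∀ n : ℕ, 2 ≤ n → gaussianTail (b n) = 1 / (n : ℝ) := hb
  have hbt := tendsto_gaussianQuantile hb'
  have hlog := tendsto_log_natCast
  set x := min x₂ y₂ with hx
  set y := min x₁ y₁ with hy
  set E : ℕ → Set Ω := fun n =>
    {ω | (rowMax ξ n ω ≤ b n + x₂ / b n ∧ rowMax η n ω ≤ b n + y₂ / b n) ∧
      (rowMin ξ n ω ≤ -b n + x₁ / b n ∧ rowMin η n ω ≤ -b n + y₁ / b n)} with hE
  set F : ℕ → ℝ := fun n => stdGaussianCDF (b n + x / b n) ^ n -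
    (stdGaussianCDF (b n + x / b n) - stdGaussianCDF (-b n + y / b n)) ^ n with hF
  -- The crossing bound for `t = 1 / (log n)^2` and `v = 1 / (8 (log n)^5)`, for which `t^2 / (2v) =
  -- 4 log n`.
  set err : ℕ → ℝ → ℝ := fun n z => 2 * (1 / Real.log n ^ 2) *
      gaussianPDFReal 0 1 (b n + z / b n - 1 / Real.log n ^ 2) +
      2 * Real.exp (-(4 * Real.log n)) with herr
  have herr0 : ∀ n z, 0 ≤ err n z := fun n z => by
    have := gaussianPDFReal_nonneg 0 1 (b n + z / b n - 1 / Real.log n ^ 2)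
    simp only [herr]
    positivity
  have herrlim : ∀ z, Tendsto (fun n : ℕ => Real.log n * (n * err n z)) atTop (𝓝 0) := fun z => by
    have := (tendsto_log_mul_gaussianPDFReal hb' z).add tendsto_log_mul_exp_neg_log
    rw [add_zero] at this
    exact this.congr fun n => by simp only [herr]; ring
  have ht0 : Tendsto (fun n : ℕ => 1 / Real.log n ^ 2) atTop (𝓝 0) :=
    tendsto_const_nhds.div_atTop ((tendsto_pow_atTop two_ne_zero).comp hlog)
  have hlarge : ∀ z, ∀ᶠ n : ℕ in atTop, 1 ≤ b n + z / b n :=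
    fun z => ((tendsto_add_div_self z).comp hbt).eventually_ge_atTop 1
  have hcross : ∀ᶠ n : ℕ in atTop, |P.real (E n) - F n| ≤
      n * ((err n y₂ + err n (-y₁)) + (err n y₂ + err n (-y₁))) := by
    filter_upwards [eventually_ge_atTop 2, hlog.eventually_gt_atTop 0, hbt.eventually_gt_atTop 0,
      hm.eventually_le_const (show (0 : ℝ) < 1 / 16 by norm_num),
      ht0.eventually_le_const one_pos, hlarge y₂, hlarge (-y₁), hlarge x, hlarge (-y)]
      with n hn hl hb0 hmn ht1 hy2 hy1 hxn hyn
    have hn0 : 0 < n := by omega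
    -- Eventually `(log n)^4 m ≤ 1/16`, hence `2(1 - ρ) = 2m / log n ≤ 1 / (8 (log n)^5)`.
    have hcorr : ∀ i, 2 * (1 - corrCoeff (ξ n i) (η n i) P) ≤ 1 / (8 * Real.log n ^ 5) := by
      intro i
      have hi : m n (((i : ℕ) + 1 : ℝ) / n) ≤ ⨆ i : Fin n, m n (((i : ℕ) + 1 : ℝ) / n) :=
        le_ciSup (f := fun i : Fin n => m n (((i : ℕ) + 1 : ℝ) / n))
          (Set.finite_range _).bddAbove i
      have h4 : Real.log n ^ 4 * m n (((i : ℕ) + 1 : ℝ) / n) ≤ 1 / 16 :=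
        (mul_le_mul_of_nonneg_left hi (by positivity)).trans hmn
      rw [hρ n hn i]
      calc _ = 2 * (Real.log n ^ 4 * m n (((i : ℕ) + 1 : ℝ) / n)) / Real.log n ^ 5 := by
            field_simp
            ring
        _ ≤ 2 * (1 / 16) / Real.log n ^ 5 := by gcongr
        _ = _ := by field_simp; norm_num
    -- Stated through `|w|` so as to serve both the upper level (`z = y₂`) and the lower one (`z =
    -- -y₁`).
    have hlevel : ∀ z w, |w| = b n + z / b n → 1 ≤ b n + z / b n → ∀ i,
        P.real {ω | ¬(ξ n i ω ≤ w ↔ η n i ω ≤ w)} ≤ err n z := by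
      intro z w hw hz i
      refine (measureReal_crossing_le (hA.gaussian n i) (hA.mean_fst n i) (hA.mean_snd n i)
        (hA.sq_fst n i) (hA.sq_snd n i) (hcorr i) (t := 1 / Real.log n ^ 2) (by positivity)
        (by rw [hw]; linarith)).trans (le_of_eq ?_)
      simp only [herr]
      rw [hw]
      congr 3
      field_simp
      norm_num
    have hu : ∀ i, P.real {ω | ¬(ξ n i ω ≤ b n + y₂ / b n ↔ η n i ω ≤ b n + y₂ / b n)} ≤
        err n y₂ + err n (-y₁) := fun i =>
      (hlevel y₂ _ (abs_of_pos (by linarith)) hy2 i).trans (le_add_of_nonneg_right (herr0 _ _))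
    have hv : ∀ i, P.real {ω | ¬(ξ n i ω ≤ -b n + y₁ / b n ↔ η n i ω ≤ -b n + y₁ / b n)} ≤
        err n y₂ + err n (-y₁) := fun i =>
      (hlevel (-y₁) _ (by
        rw [show -b n + y₁ / b n = -(b n + -y₁ / b n) by ring, abs_neg]
        exact abs_of_pos (by linarith)) hy1 i).trans (le_add_of_nonneg_left (herr0 _ _))
    have hrow := abs_measureReal_row_sub_le (u₁ := b n + x₂ / b n) (v₁ := -b n + x₁ / b n) hu hv
    have eE : E n = {ω | ((∀ i, ξ n i ω ≤ b n + x₂ / b n) ∧ ∀ i, η n i ω ≤ b n + y₂ / b n) ∧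
        (∃ i, ξ n i ω ≤ -b n + x₁ / b n) ∧ ∃ i, η n i ω ≤ -b n + y₁ / b n} := by
      ext ω
      simp only [hE, Set.mem_ofPred_eq, rowMax_le_iff _ hn0, rowMin_le_iff _ hn0]
    have eu : min (b n + x₂ / b n) (b n + y₂ / b n) = b n + x / b n := by
      rw [min_add_add_left, min_div_div_right hb0.le]
    have ev : min (-b n + x₁ / b n) (-b n + y₁ / b n) = -b n + y / b n := by
      rw [min_add_add_left, min_div_div_right hb0.le]
    rw [← eE, eu, ev] at hrow
    rwa [measureReal_max_le_min_le (fun i => (hA.gaussian n i).fst.aemeasurable)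
      (fun i => map_eq_stdGaussian (hA.gaussian n i).fst (hA.mean_fst n i) (hA.sq_fst n i))
      ((hA.indep n).comp (fun _ => Prod.fst) fun _ => measurable_fst)
      (by rw [neg_div] at hyn; linarith)] at hrow
  have hdiff : Tendsto (fun n : ℕ => 4 * Real.log n * (P.real (E n) - F n)) atTop (𝓝 0) := by
    have hlim := ((herrlim y₂).add (herrlim (-y₁))).const_mul 8
    rw [add_zero, mul_zero] at hlim
    refine squeeze_zero_norm' ?_ hlim
    filter_upwards [hcross, hlog.eventually_gt_atTop 0] with n h hl
    rw [norm_mul, Real.norm_of_nonneg (by positivity), Real.norm_eq_abs]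
    refine (mul_le_mul_of_nonneg_left h (by positivity)).trans (le_of_eq ?_)
    ring
  have h := (hdiff.add (tendsto_log_mul_max_min hb' x y)).congr fun n => by
    rw [← mul_add, sub_add_sub_cancel]
  rw [zero_add] at h
  have eH : Hzero x₂ y₂ = gumbel x := rfl
  have eT : Htilde x₁ y₁ = 1 - gumbel (-y) := Htilde_eq x₁ y₁
  rw [eH, eT]
  convert! h using 2
  -- With `f z = (z^2 - 2z) e^z Λ(-z)`, the `max` term cancels one of `f x₁`, `f y₁`, leaving `f
  -- (min x₁ y₁)`, because `min (-x₁) (-y₁) = -max x₁ y₁`.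
  rw [hy, Hzero]
  rcases le_total x₁ y₁ with hxy | hxy
  · rw [min_eq_left hxy, max_eq_right hxy, min_eq_right (neg_le_neg hxy)]
    ring
  · rw [min_eq_right hxy, max_eq_left hxy, min_eq_left (neg_le_neg hxy)]
    ring
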